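/- In this statement "group" means infinite abelian group. Let $p$ be a prime. A $p$-group $G$ (a group in which every element has order a power of $p$) is called separable if it has no nonzero element of infinite $p$-height, i.e. $\bigcap_{k<\omega} p^kG=\{0\}$. A subgroup $H\subseteq G$ is pure if $mH=mG\cap H$ for every natural number $m$. A separable $p$-group $G$ is purely universal in the cardinal $\lambda$ if $|G|=\lambda$ and every separable $p$-group $H$ with $|H|\le\lambda$ is isomorphic to a pure subgroup of $G$. For every prime $p$ and every integer $n\ge 2$: there exists a purely universal separable $p$-group in $\aleph_n$ if and only if $2^{\aleph_0}\le\aleph_n$. -/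

import Mathlib

universe u

open Cardinal

/-- A subgroup `H` of an abelian group `G` is pure if `n H = n G ∩ H` for every natural `n`. -/
def IsPureSubgroup {G : Type u} [AddCommGroup G] (H : AddSubgroup G) : Prop :=
  ∀ n : ℕ, H.map (nsmulAddMonoidHom n) = (nsmulAddMonoidHom (α := G) n).range ⊓ H

/-- A separable `p`-group: an abelian `p`-group in which no nonzero element has infinite
`p`-height, that is, the intersection of the subgroups `p ^ k G` is zero. -/
structure IsSeparablePGroup (p : ℕ) (G : Type u) [AddCommGroup G] : Prop where
  isPGroup : IsPGroup p (Multiplicative G)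
  eq_zero_of_infinite_height : ∀ g : G, (∀ k : ℕ, ∃ x : G, p ^ k • x = g) → g = 0

/-- `G` is purely universal, in cardinality `κ`, for the infinite abelian groups in the class `C`:
it belongs to `C`, has cardinality `κ`, and every infinite group in `C` of cardinality at most `κ`
is isomorphic to a pure subgroup of `G`. -/
structure IsPurelyUniversal (C : (A : Type u) → [AddCommGroup A] → Prop) (κ : Cardinal.{u})
    (G : Type u) [AddCommGroup G] : Prop where
  mem : C G
  card_eq : #G = κ
  exists_pure : ∀ (H : Type u) [AddCommGroup H], Infinite H → C H → #H ≤ κ →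
    ∃ K : AddSubgroup G, IsPureSubgroup K ∧ Nonempty (H ≃+ K)

/-! Nonexistence: let κ be regular with ℵ₁ < κ < 2^ℵ₀, and enumerate a supposed universal G in order
type κ. By club guessing (`IsRegularOrder.exists_club_guessing`, where κ > ℵ₁ is used), sequences `c
δ` can be fixed in advance so that every closure function is respected by all points of some `c δ`.
For X ⊆ ℕ, build a separable group containing the series ∑_{j ∈ X} p^j e(c δ j, j) and their divided
tails. After a pure embedding in G, some δ-series has an image g for which membership in (part of G
below c δ n) + p^m G holds exactly when X misses [n, m) (`IsRegularOrder.exists_series_invariant`).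
Thus (δ, g) determines X, and 2^ℵ₀ sets inject into κ pairs.

Existence: if 2^ℵ₀ ≤ ℵ_n then ℵ_n^ℵ₀ = ℵ_n. Let D be a direct sum of ℵ_n circles; the torsion part
of ∏ D[p^k] is universal, since A maps to it through embeddings of the quotients A/p^k A in D. -/

/-! ### Regular well-orders and club guessing -/

/-- `a` is closed under `F` if `F` maps the initial segment below `a` to itself. -/
def ClosedUnder {L : Type u} [LT L] (F : L → L) (a : L) : Prop := ∀ b < a, F b < a

theorem ClosedUnder.mono {L : Type u} [Preorder L] {F F' : L → L} (h : ∀ x, F x ≤ F' x) {a : L}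
    (ha : ClosedUnder F' a) : ClosedUnder F a := fun b hb => (h b).trans_lt (ha b hb)

/-- A well-order whose small subsets are strictly bounded, with small initial segments. -/
structure IsRegularOrder (L : Type u) [LinearOrder L] [WellFoundedLT L] : Prop where
  bdd : ∀ s : Set L, #s < #L → ∃ b, ∀ x ∈ s, x < b
  iic : ∀ a : L, #(Set.Iic a) < #L

theorem isRegularOrder_toType {κ : Cardinal.{u}} (h : κ.IsRegular) :
    IsRegularOrder κ.ord.ToType where
  bdd s hs := by
    by_contra! H
    have hc : IsCofinal s := fun b => H b
    have h1 := Order.cof_le hc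
    rw [Ordinal.cof_toType, h.cof_ord] at h1
    rw [mk_ord_toType] at hs
    exact absurd hs (not_lt.2 h1)
  iic a := by
    refine mk_Iic_lt a (by simp) (by simpa using h.1)

theorem exists_isRegularOrder {κ : Cardinal.{u}} (h : κ.IsRegular) :
    ∃ (L : Type u) (_ : LinearOrder L) (_ : WellFoundedLT L), IsRegularOrder L ∧ #L = κ :=
  ⟨_, _, inferInstance, isRegularOrder_toType h, mk_ord_toType κ⟩

section
variable {L : Type u} [LinearOrder L] [WellFoundedLT L]

theorem IsRegularOrder.bdd_range (hL : IsRegularOrder L) {ι : Type u} (f : ι → L) (h : #ι < #L) :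
    ∃ b, ∀ i, f i < b := by
  obtain ⟨b, hb⟩ := hL.bdd (Set.range f) (mk_range_le.trans_lt h)
  exact ⟨b, fun i => hb _ ⟨i, rfl⟩⟩

theorem IsRegularOrder.bdd_countable (hL : IsRegularOrder L) (h0 : ℵ₀ < #L) {ι : Type*}
    [Countable ι] (f : ι → L) : ∃ b, ∀ i, f i < b := by
  obtain ⟨b, hb⟩ := hL.bdd (Set.range f) ((Set.countable_range f).le_aleph0.trans_lt h0)
  exact ⟨b, fun i => hb _ ⟨i, rfl⟩⟩

theorem IsRegularOrder.exists_least_strict_bound (hL : IsRegularOrder L) (h0 : ℵ₀ < #L)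
    (s : ℕ → L) : ∃ γ, (∀ n, s n < γ) ∧ ∀ β < γ, ∃ n, β ≤ s n := by
  obtain ⟨γ, h1, h2⟩ := (wellFounded_lt (α := L)).has_min {γ | ∀ n, s n < γ}
    (hL.bdd_countable h0 s)
  refine ⟨γ, h1, fun β hβ => ?_⟩
  by_contra! H
  exact h2 β H hβ

theorem IsRegularOrder.exists_closedUnder_gt (hL : IsRegularOrder L) (h0 : ℵ₀ < #L)
    (F : L → L) (a : L) : ∃ γ, a < γ ∧ ClosedUnder F γ := by
  have hstep : ∀ a, ∃ b, a < b ∧ ∀ x ≤ a, F x < b := fun a => by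
    obtain ⟨b, hb⟩ := hL.bdd_range (fun x : Set.Iic a => max x.1 (F x)) (hL.iic a)
    exact ⟨b, (le_max_left _ _).trans_lt (hb ⟨a, le_rfl⟩),
      fun x hx => (le_max_right _ _).trans_lt (hb ⟨x, hx⟩)⟩
  choose nxt h1 h2 using hstep
  obtain ⟨γ, hγ, hγ'⟩ := hL.exists_least_strict_bound h0 (fun n => nxt^[n] a)
  refine ⟨γ, hγ 0, fun β hβ => ?_⟩
  obtain ⟨n, hn⟩ := hγ' β hβ
  have := hγ (n + 1)
  rw [Function.iterate_succ_apply'] at this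
  exact (h2 _ β hn).trans this

/-- A supremum of closed points is closed, and the least element is vacuously closed. -/
theorem exists_isGreatest_closedUnder (F : L → L) (a : L) :
    ∃ d, IsGreatest {c | ClosedUnder F c ∧ c ≤ a} d := by
  obtain ⟨γ, h1, h2⟩ := (wellFounded_lt (α := L)).has_min
    (upperBounds {c | ClosedUnder F c ∧ c ≤ a}) ⟨a, fun c hc => hc.2⟩
  refine ⟨γ, ⟨fun β hβ => ?_, not_lt.1 (h2 a fun c hc => hc.2)⟩, h1⟩
  have : β ∉ upperBounds {c | ClosedUnder F c ∧ c ≤ a} := fun h => h2 β h hβ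
  simp only [mem_upperBounds, not_forall, not_le] at this
  obtain ⟨c, hc, hβc⟩ := this
  exact (hc.1 β hβc).trans_le (h1 hc)

/-- Transfinite recursion: each stage has fewer than `#L` predecessors, so regularity bounds them
pointwise. -/
theorem IsRegularOrder.exists_dominating_chain {κ : Cardinal.{u}} (hL : IsRegularOrder L)
    (hκ : κ < #L) (Φ : (L → L) → L → L) :
    ∃ G : κ.ord.ToType → L → L, ∀ ζ, ∀ ξ < ζ, ∀ x, G ξ x ≤ G ζ x ∧ Φ (G ξ) x ≤ G ζ x := by
  have step : ∀ (ζ : κ.ord.ToType) (g : ∀ ξ, ξ < ζ → L → L), ∃ h : L → L,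
      ∀ ξ hξ x, g ξ hξ x ≤ h x ∧ Φ (g ξ hξ) x ≤ h x := by
    intro ζ g
    have : ∀ x, ∃ b, ∀ ξ : Set.Iio ζ, max (g ξ.1 ξ.2 x) (Φ (g ξ.1 ξ.2) x) < b := fun x =>
      hL.bdd_range _ ((mk_Iio_lt ζ (by simp)).trans (by simpa using hκ))
    choose h hh using this
    exact ⟨h, fun ξ hξ x => max_le_iff.1 (hh x ⟨ξ, hξ⟩).le⟩
  choose B hB using step
  refine ⟨(wellFounded_lt (α := κ.ord.ToType)).fix B, fun ζ ξ hξ x => ?_⟩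
  rw [WellFounded.fix_eq _ B ζ]
  exact hB ζ (fun ξ _ => (wellFounded_lt (α := κ.ord.ToType)).fix B ξ) ξ hξ x

/-- A weak form of club guessing at cofinality `ω`, for regular cardinals above `ℵ₁`. -/
theorem IsRegularOrder.exists_club_guessing (hL : IsRegularOrder L) (h1 : ℵ₁ < #L) :
    ∃ c : L → ℕ → L, (∀ δ, StrictMono (c δ)) ∧
      ∀ F : L → L, ∃ δ, ∀ n, ClosedUnder F (c δ n) := by
  have h0 : ℵ₀ < #L := aleph0_lt_aleph_one.trans h1
  have hreg := isRegularOrder_toType isRegular_aleph_one.{u}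
  choose d hd using exists_isGreatest_closedUnder (L := L)
  let P : L → (ℕ → L) → Prop := fun δ s => (∀ n, s n < δ) ∧ ∀ γ < δ, ∃ n, γ ≤ s n
  obtain ⟨c, hc⟩ : ∃ c : L → ℕ → L, ∀ δ, (∃ s, P δ s) → P δ (c δ) := by
    refine ⟨fun δ => Classical.epsilon (h := ⟨fun _ => δ⟩) (P δ), fun δ h => ?_⟩
    exact Classical.epsilon_spec_aux _ _ h
  let good : (L → L) → L → Prop := fun F δ => ∀ γ < δ, ∃ b, γ < b ∧ b < δ ∧ ClosedUnder F b
  have hgood : ∀ F : L → L, ∃ δ, P δ (c δ) ∧ good F δ := by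
    intro F
    have : Nonempty L := mk_ne_zero_iff.1 (by rintro h; simp [h] at h0)
    obtain ⟨a⟩ := this
    choose nxt hn1 hn2 using hL.exists_closedUnder_gt h0 F
    obtain ⟨δ, hδ, hδ'⟩ := hL.exists_least_strict_bound h0 (fun n => nxt^[n] a)
    refine ⟨δ, hc δ ⟨_, hδ, hδ'⟩, fun γ hγ => ?_⟩
    obtain ⟨n, hn⟩ := hδ' γ hγ
    have := hδ (n + 1)
    rw [Function.iterate_succ_apply'] at this
    exact ⟨_, hn.trans_lt (hn1 _), this, hn2 _⟩
  -- Arbitrary cofinal sequences are corrected by pushing each term down to the greatest `F`-closed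
  -- point. If no `F` sufficed, counterexamples could be iterated ω₁ times.
  obtain ⟨F, hF⟩ : ∃ F : L → L, ∀ F' : L → L, ∃ δ, P δ (c δ) ∧ good F δ ∧
      ∀ n, ClosedUnder F' (d F (c δ n)) := by
    by_contra! H
    choose Φ hΦ using H
    obtain ⟨G, hG⟩ := hL.exists_dominating_chain h1 Φ
    have : ∀ x, ∃ b, ∀ ζ, G ζ x < b := fun x => hL.bdd_range (fun ζ => G ζ x) (by simpa using h1)
    choose G' hG' using this
    obtain ⟨δ, hP, hδ⟩ := hgood G'
    have hδζ : ∀ ζ, good (G ζ) δ := fun ζ γ hγ => by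
      obtain ⟨b, hb1, hb2, hb3⟩ := hδ γ hγ
      exact ⟨b, hb1, hb2, hb3.mono fun x => (hG' x ζ).le⟩
    have hmono : ∀ a ξ ζ, ξ ≤ ζ → d (G ζ) a ≤ d (G ξ) a := by
      intro a ξ ζ h
      rcases h.eq_or_lt with rfl | h
      · exact le_rfl
      · exact (hd (G ξ) a).2 ⟨(hd (G ζ) a).1.1.mono fun x => (hG ζ ξ h x).1, (hd (G ζ) a).1.2⟩
    have hne : Nonempty (ℵ₁ : Cardinal.{u}).ord.ToType := by
      rw [← mk_ne_zero_iff, mk_ord_toType]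
      exact (aleph_pos 1).ne'
    -- A decreasing function into a well-order is eventually constant.
    have hstab : ∀ a, ∃ ξ, ∀ ζ, ξ ≤ ζ → d (G ζ) a = d (G ξ) a := by
      intro a
      obtain ⟨_, ⟨ξ, rfl⟩, hξ⟩ := (wellFounded_lt (α := L)).has_min
        (Set.range fun ζ => d (G ζ) a) (Set.range_nonempty _)
      exact ⟨ξ, fun ζ h => le_antisymm (hmono a ξ ζ h) (not_lt.1 (hξ _ ⟨ζ, rfl⟩))⟩
    choose st hst using hstab
    have hW : ℵ₀ < #(ℵ₁ : Cardinal.{u}).ord.ToType := by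
      rw [mk_ord_toType]; exact aleph0_lt_aleph_one
    -- Only countably many points `c δ n` matter, so one ζ < ω₁ stabilises them all; at a later ζ'
    -- the same points are also closed under `Φ (G ζ)`.
    obtain ⟨ζ, hζ⟩ := hreg.bdd_countable hW (fun n => st (c δ n))
    obtain ⟨ζ', hζ'⟩ := hreg.bdd_countable hW (fun _ : Unit => ζ)
    replace hζ' := hζ' ()
    obtain ⟨n, hn⟩ := hΦ (G ζ) δ hP (hδζ ζ)
    apply hn
    rw [hst (c δ n) ζ (hζ n).le, ← hst (c δ n) ζ' ((hζ n).trans hζ').le]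
    exact (hd (G ζ') (c δ n)).1.1.mono fun x => (hG ζ' ζ hζ' x).2
  have hseq : ∀ δ, P δ (c δ) → good F δ →
      ∃ s : ℕ → L, StrictMono s ∧ ∀ k, ∃ n, s k = d F (c δ n) := by
    intro δ hP hδ
    have : NoMaxOrder (Set.range fun n => d F (c δ n)) := ⟨by
      rintro ⟨_, n, rfl⟩
      obtain ⟨b, hb1, hb2, hb3⟩ := hδ (d F (c δ n)) ((hd F _).1.2.trans_lt (hP.1 n))
      obtain ⟨m, hm⟩ := hP.2 b hb2
      exact ⟨⟨_, m, rfl⟩, hb1.trans_le ((hd F (c δ m)).2 ⟨hb3, hm⟩)⟩⟩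
    have : Nonempty (Set.range fun n => d F (c δ n)) := (Set.range_nonempty _).to_subtype
    obtain ⟨f, hf⟩ := Nat.exists_strictMono (Set.range fun n => d F (c δ n))
    refine ⟨fun k => (f k).1, fun a b h => hf h, fun k => ?_⟩
    obtain ⟨n, hn⟩ := (f k).2
    exact ⟨n, hn.symm⟩
  -- `s₀` is a filler sequence for those δ that guess nothing.
  obtain ⟨δ₀, hP₀, hg₀, -⟩ := hF id
  obtain ⟨s₀, hs₀, -⟩ := hseq δ₀ hP₀ hg₀
  have hall : ∀ δ, ∃ s : ℕ → L, StrictMono s ∧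
      (P δ (c δ) → good F δ → ∀ k, ∃ n, s k = d F (c δ n)) := by
    intro δ
    by_cases h : P δ (c δ) ∧ good F δ
    · obtain ⟨s, hs, hs'⟩ := hseq δ h.1 h.2
      exact ⟨s, hs, fun _ _ => hs'⟩
    · exact ⟨s₀, hs₀, fun h1 h2 => absurd ⟨h1, h2⟩ h⟩
  choose s hs hs' using hall
  refine ⟨s, hs, fun F' => ?_⟩
  obtain ⟨δ, hP, hg, hδ⟩ := hF F'
  refine ⟨δ, fun k => ?_⟩
  obtain ⟨n, hn⟩ := hs' δ hP hg k
  exact hn ▸ hδ n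

end

/-! ### Separable groups built from divided series -/

section
variable {L : Type u} [LinearOrder L]

theorem isPGroup_multiplicative_iff {p : ℕ} {A : Type*} [AddCommGroup A] :
    IsPGroup p (Multiplicative A) ↔ ∀ a : A, ∃ k : ℕ, p ^ k • a = 0 :=
  Iff.rfl

/-- The series `∑ p ^ (j - i) e (s j) j` over the `j ∈ X` with `i ≤ j`, where `e a j` generates a
cyclic group of order `p ^ (j + 1)`. -/
noncomputable def dividedSeries (p : ℕ) (s : ℕ → L) (X : Set ℕ) (i : ℕ) :
    (q : L × ℕ) → ZMod (p ^ (q.2 + 1)) :=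
  open Classical in fun q => if q.1 = s q.2 ∧ q.2 ∈ X ∧ i ≤ q.2 then (p : ZMod _) ^ (q.2 - i) else 0

theorem ZMod.pow_nsmul_eq_zero_of_lt {p j m : ℕ} (h : j < m) (x : ZMod (p ^ (j + 1))) :
    p ^ m • x = 0 := by
  obtain ⟨t, rfl⟩ := Nat.exists_eq_add_of_lt h
  rw [nsmul_eq_mul, (ZMod.natCast_eq_zero_iff _ _).2 (pow_dvd_pow p (by omega)), zero_mul]

open Classical in
-- Modulo `p ^ m` only a finite head of the series survives, since the divided tail is itself in
-- `seriesGroup`.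
theorem dividedSeries_zero (p : ℕ) (s : ℕ → L) (X : Set ℕ) (m : ℕ) :
    dividedSeries p s X 0 =
      (∑ j ∈ (Finset.range m).filter (· ∈ X), p ^ j •
        (Pi.single (s j, j) 1 : (q : L × ℕ) → ZMod (p ^ (q.2 + 1)))) +
      p ^ m • dividedSeries p s X m := by
  funext ⟨a, k⟩
  rw [Pi.add_apply, Finset.sum_apply]
  have h1 : ∀ j ∈ (Finset.range m).filter (· ∈ X), j ≠ k → (p ^ j •
        (Pi.single (s j, j) 1 : (q : L × ℕ) → ZMod (p ^ (q.2 + 1)))) (a, k) = 0 := by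
    intro j _ hj
    rw [Pi.smul_apply, Pi.single_eq_of_ne (by simp [Ne.symm hj]), smul_zero]
  by_cases hk : k ∈ (Finset.range m).filter (· ∈ X)
  · rw [Finset.sum_eq_single_of_mem k hk fun j hj => h1 j hj]
    simp only [Finset.mem_filter, Finset.mem_range] at hk
    by_cases ha : a = s k
    · subst ha
      simp [dividedSeries, hk.1, hk.2]
    · simp [dividedSeries, ha]
  · rw [Finset.sum_eq_zero fun j hj => h1 j hj (by rintro rfl; exact hk hj), zero_add]
    simp only [Finset.mem_filter, Finset.mem_range, not_and] at hk
    simp only [dividedSeries, Pi.smul_apply]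
    by_cases hX : k ∈ X
    · have : m ≤ k := by by_contra! h; exact hk h hX
      split_ifs <;> simp_all [← pow_add]
    · simp [hX]

/-- The generators of the group `seriesGroup`. -/
noncomputable def seriesGenerators (p : ℕ) (c : L → ℕ → L) (X : Set ℕ) :
    (L × ℕ) ⊕ (L × ℕ) → (q : L × ℕ) → ZMod (p ^ (q.2 + 1)) :=
  Sum.elim (fun q => Pi.single q 1) (fun q => dividedSeries p (c q.1) X q.2)

/-- The group generated by a sum of cyclic groups and by the divided series along the sequences
`c δ`. -/
noncomputable def seriesGroup (p : ℕ) (c : L → ℕ → L) (X : Set ℕ) :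
    Submodule ℤ ((q : L × ℕ) → ZMod (p ^ (q.2 + 1))) :=
  Submodule.span ℤ (Set.range (seriesGenerators p c X))

theorem single_mem_seriesGroup (p : ℕ) (c : L → ℕ → L) (X : Set ℕ) (q : L × ℕ) :
    Pi.single q 1 ∈ seriesGroup p c X :=
  Submodule.subset_span ⟨Sum.inl q, rfl⟩

theorem dividedSeries_mem_seriesGroup (p : ℕ) (c : L → ℕ → L) (X : Set ℕ) (δ : L) (i : ℕ) :
    dividedSeries p (c δ) X i ∈ seriesGroup p c X :=
  Submodule.subset_span ⟨Sum.inr (δ, i), rfl⟩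

theorem countable_support_of_mem_seriesGroup {p : ℕ} {c : L → ℕ → L} {X : Set ℕ}
    {f : (q : L × ℕ) → ZMod (p ^ (q.2 + 1))} (hf : f ∈ seriesGroup p c X) :
    {q | f q ≠ 0}.Countable := by
  induction hf using Submodule.span_induction with
  | mem x hx =>
    obtain ⟨q | ⟨δ, i⟩, rfl⟩ := hx
    · refine Set.Countable.mono ?_ (Set.countable_singleton q)
      intro q' hq'
      by_contra h
      exact hq' (Pi.single_eq_of_ne h _)
    · refine Set.Countable.mono ?_ (Set.countable_range fun j => (c δ j, j))
      intro q' hq'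
      refine ⟨q'.2, ?_⟩
      by_contra h
      exact hq' (if_neg fun h' => h (Prod.ext h'.1.symm rfl))
  | zero => simp
  | add x y _ _ hx hy =>
    refine Set.Countable.mono ?_ (hx.union hy)
    intro q hq
    by_contra h
    simp only [Set.mem_union, Set.mem_ofPred_eq, not_or, not_not] at h
    exact hq (by rw [Pi.add_apply, h.1, h.2, add_zero])
  | smul a x _ hx =>
    refine Set.Countable.mono ?_ hx
    intro q hq h
    refine hq ?_
    rw [Pi.smul_apply, h, smul_zero]

theorem isSeparablePGroup_seriesGroup (p : ℕ) (c : L → ℕ → L) (X : Set ℕ) :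
    IsSeparablePGroup p (seriesGroup p c X) where
  isPGroup := by
    rw [isPGroup_multiplicative_iff]
    rintro ⟨f, hf⟩
    simp only [Subtype.ext_iff, Submodule.coe_smul_of_tower, ZeroMemClass.coe_zero]
    induction hf using Submodule.span_induction with
    | mem x hx =>
      obtain ⟨⟨a, k⟩ | ⟨δ, i⟩, rfl⟩ := hx
      · refine ⟨k + 1, ?_⟩
        funext q
        by_cases h : q = (a, k)
        · subst h
          exact ZMod.pow_nsmul_eq_zero_of_lt (Nat.lt_succ_self _) _
        · simp [seriesGenerators, Pi.single_eq_of_ne h]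
      · refine ⟨i + 1, ?_⟩
        funext ⟨a, k⟩
        simp only [seriesGenerators, Sum.elim_inr, Pi.smul_apply, dividedSeries, Pi.zero_apply]
        split_ifs with h
        · obtain ⟨t, rfl⟩ := Nat.exists_eq_add_of_le h.2.2
          have := ZMod.pow_nsmul_eq_zero_of_lt (p := p) (Nat.lt_succ_self (i + t)) 1
          rw [nsmul_eq_mul, mul_one] at this
          rw [nsmul_eq_mul, ← this]
          push_cast
          rw [← pow_add]
          congr 1
          omega
        · simp
    | zero => exact ⟨0, by simp⟩
    | add x y _ _ hx hy =>
      obtain ⟨k, hk⟩ := hx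
      obtain ⟨l, hl⟩ := hy
      refine ⟨k + l, ?_⟩
      rw [smul_add, pow_add, mul_smul, mul_smul, smul_comm, hk, hl, smul_zero, smul_zero, zero_add]
    | smul a x _ hx =>
      obtain ⟨k, hk⟩ := hx
      exact ⟨k, by rw [smul_comm, hk, smul_zero]⟩
  eq_zero_of_infinite_height := by
    rintro ⟨f, hf⟩ h
    ext q
    obtain ⟨x, hx⟩ := h (q.2 + 1)
    have : p ^ (q.2 + 1) • x.1 q = f q := congrFun (congrArg Subtype.val hx) q
    rw [ZMod.pow_nsmul_eq_zero_of_lt (Nat.lt_succ_self _)] at this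
    exact this.symm

theorem mk_seriesGroup_le [Infinite L] (p : ℕ) (c : L → ℕ → L) (X : Set ℕ) :
    #(seriesGroup p c X) ≤ #L := by
  rw [seriesGroup, ← Finsupp.range_linearCombination]
  refine (mk_le_of_surjective
    (LinearMap.surjective_rangeRestrict (Finsupp.linearCombination ℤ _))).trans ?_
  simp

theorem infinite_seriesGroup [Nonempty L] {p : ℕ} (hp : p.Prime) (c : L → ℕ → L) (X : Set ℕ) :
    Infinite (seriesGroup p c X) := by
  obtain ⟨a⟩ := ‹Nonempty L›
  refine Infinite.of_injective
    (fun k : ℕ => (⟨Pi.single (a, k) 1, single_mem_seriesGroup p c X _⟩ : seriesGroup p c X)) ?_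
  intro k l h
  by_contra hkl
  have := congrFun (congrArg Subtype.val h) (a, k)
  have hne : ((a, k) : L × ℕ) ≠ (a, l) := by simpa using hkl
  simp only [Pi.single_eq_same, Pi.single_eq_of_ne hne] at this
  have : Fact (1 < p ^ (k + 1)) := ⟨Nat.one_lt_pow (by omega) hp.one_lt⟩
  exact one_ne_zero ‹(1 : ZMod (p ^ (k + 1))) = 0›

/-! ### Recovering X, and nonexistence below the continuum -/

variable [WellFoundedLT L]

theorem IsRegularOrder.exists_series_invariant (hL : IsRegularOrder L) (h0 : ℵ₀ < #L)
    {p : ℕ} (hp : p.Prime) {G : Type u} [AddCommGroup G] (r : G ≃ L) {c : L → ℕ → L}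
    (hc : ∀ δ, StrictMono (c δ)) (hc0 : ∀ δ n, ∃ b, b < c δ n)
    (hguess : ∀ F : L → L, ∃ δ, ∀ n, ClosedUnder F (c δ n)) {X : Set ℕ}
    {φ : seriesGroup p c X →+ G}
    (hpure : ∀ (m : ℕ) h g, p ^ m • g = φ h → ∃ w, p ^ m • w = h) :
    ∃ δ g, ∀ n m, (∃ y z, r y < c δ n ∧ g = y + p ^ m • z) ↔ ∀ j ∈ X, ¬ (n ≤ j ∧ j < m) := by
  let e : L × ℕ → seriesGroup p c X := fun q => ⟨Pi.single q 1, single_mem_seriesGroup p c X q⟩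
  let x : L → ℕ → seriesGroup p c X :=
    fun δ i => ⟨dividedSeries p (c δ) X i, dividedSeries_mem_seriesGroup p c X δ i⟩
  -- `η g m` is a chosen element whose image agrees with `g` modulo `p ^ m`, when one exists; its
  -- choice depends on `g` and `m` alone, so `F` can bound its support.
  obtain ⟨η, hη⟩ : ∃ η : G → ℕ → seriesGroup p c X, ∀ g m,
      (∃ h z, φ h = g + p ^ m • z) → ∃ z, φ (η g m) = g + p ^ m • z := by
    choose η hη using fun (g : G) (m : ℕ) =>
      (show ∃ h, (∃ h z, φ h = g + p ^ m • z) → ∃ z, φ h = g + p ^ m • z by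
        by_cases H : ∃ h z, φ h = g + p ^ m • z
        · exact H.imp fun _ h _ => h
        · exact ⟨0, fun h => absurd h H⟩)
    exact ⟨η, hη⟩
  have hf1 : ∀ g, ∃ b, ∀ m, ∀ q : L × ℕ, (η g m).1 q ≠ 0 → q.1 < b := by
    intro g
    have : Countable (Σ m, {q // (η g m).1 q ≠ 0}) := by
      have : ∀ m, Countable {q // (η g m).1 q ≠ 0} := fun m =>
        (countable_support_of_mem_seriesGroup (η g m).2).to_subtype
      infer_instance
    obtain ⟨b, hb⟩ := hL.bdd_countable h0 fun t : Σ m, {q // (η g m).1 q ≠ 0} => t.2.1.1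
    exact ⟨b, fun m q hq => hb ⟨m, q, hq⟩⟩
  choose f1 hf1 using hf1
  choose f2 hf2 using fun b => hL.bdd_countable h0 fun j : ℕ => r (φ (e (b, j)))
  have hF : ∀ b, ∃ b', ∀ t : Set.Iic b × Set.Iic b,
      max (max (r 0) (f2 b)) (max (f1 (r.symm t.1)) (r (r.symm t.1 + r.symm t.2))) < b' :=
    fun b => hL.bdd_range _ (by
      rw [← mul_def]
      exact mul_lt_of_lt h0.le (hL.iic b) (hL.iic b))
  choose F hF using hF
  have hF0 : ∀ b, r 0 < F b := fun b =>
    (le_max_of_le_left (le_max_left _ _)).trans_lt (hF b ⟨⟨b, le_rfl⟩, ⟨b, le_rfl⟩⟩)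
  have hF2 : ∀ b, f2 b < F b := fun b =>
    (le_max_of_le_left (le_max_right _ _)).trans_lt (hF b ⟨⟨b, le_rfl⟩, ⟨b, le_rfl⟩⟩)
  have hF1 : ∀ g, f1 g < F (r g) := fun g => by
    refine lt_of_le_of_lt ?_ (hF (r g) ⟨⟨r g, le_rfl⟩, ⟨r g, le_rfl⟩⟩)
    simp
  have hFadd : ∀ y z, r (y + z) < F (max (r y) (r z)) := fun y z => by
    refine lt_of_le_of_lt ?_ (hF (max (r y) (r z)) ⟨⟨r y, le_max_left _ _⟩, ⟨r z, le_max_right _ _⟩⟩)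
    simp
  obtain ⟨δ, hδ⟩ := hguess F
  refine ⟨δ, φ (x δ 0), fun n m => ⟨?_, fun hX => ?_⟩⟩
  · rintro ⟨y, z, hy, hyz⟩ j hj ⟨hnj, hjm⟩
    obtain ⟨z', hz'⟩ := hη y m ⟨_, z, hyz⟩
    obtain ⟨w, hw⟩ := hpure m (x δ 0 - η y m) (z - z') (by
      rw [map_sub, hyz, hz', smul_sub]; abel)
    -- In this cyclic group of order `p ^ (j + 1)`, `p ^ m` acts as zero and `η y m`, supported
    -- below `c δ n`, vanishes, but the series has the nonzero entry `p ^ j`.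
    have hcoord := congrFun (congrArg Subtype.val hw) (c δ j, j)
    have h1 : (p ^ m • w).1 (c δ j, j) = 0 :=
      ZMod.pow_nsmul_eq_zero_of_lt (j := j) hjm (w.1 (c δ j, j))
    have h2 : (η y m).1 (c δ j, j) = 0 := by
      by_contra h
      have := hf1 y m _ h
      exact absurd ((this.trans (hF1 y)).trans (hδ n _ hy)) (not_lt.2 ((hc δ).monotone hnj))
    have h3 : (x δ 0 - η y m).1 (c δ j, j) = (p : ZMod (p ^ (j + 1))) ^ j := by
      change dividedSeries p (c δ) X 0 (c δ j, j) - (η y m).1 (c δ j, j) = _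
      rw [h2, sub_zero]
      simp [dividedSeries, hj]
    rw [h1, h3] at hcoord
    have := (ZMod.natCast_eq_zero_iff (p ^ j) (p ^ (j + 1))).1 (by push_cast; exact hcoord.symm)
    rw [Nat.pow_dvd_pow_iff_le_right hp.one_lt] at this
    omega
  · classical
    let A : AddSubmonoid G :=
      { carrier := {y | r y < c δ n}
        zero_mem' := by
          obtain ⟨b, hb⟩ := hc0 δ n
          exact (hF0 b).trans (hδ n b hb)
        add_mem' := fun {y z} hy hz => (hFadd y z).trans (hδ n _ (max_lt hy hz)) }
    have hx : x δ 0 = (∑ j ∈ (Finset.range m).filter (· ∈ X), p ^ j • e (c δ j, j)) +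
        p ^ m • x δ m := by
      apply Subtype.ext
      simpa [e, x] using dividedSeries_zero p (c δ) X m
    refine ⟨_, φ (x δ m), ?_, by rw [hx, map_add, map_nsmul]⟩
    change _ ∈ A
    rw [map_sum]
    refine sum_mem fun j hj => ?_
    rw [map_nsmul]
    refine nsmul_mem ?_ _
    simp only [Finset.mem_filter, Finset.mem_range] at hj
    have hjn : j < n := by
      by_contra! h
      exact hX j hj.2 ⟨h, hj.1⟩
    exact ((hf2 _ j).trans (hF2 _)).trans (hδ n _ (hc δ hjn))

end

theorem IsPureSubgroup.exists_smul_eq {G H : Type u} [AddCommGroup G] [AddCommGroup H]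
    {K : AddSubgroup G} (hK : IsPureSubgroup K) (e : H ≃+ K) {n : ℕ} {h : H} {g : G}
    (hg : n • g = e h) : ∃ w, n • w = h := by
  have : (e h : G) ∈ (nsmulAddMonoidHom (α := G) n).range ⊓ K := ⟨⟨g, hg⟩, (e h).2⟩
  rw [← hK n] at this
  obtain ⟨k, hk, hk'⟩ := this
  refine ⟨e.symm ⟨k, hk⟩, e.injective (Subtype.ext ?_)⟩
  rw [map_nsmul, AddEquiv.apply_symm_apply]
  exact hk'

theorem not_isPurelyUniversal_of_lt_continuum {κ : Cardinal.{u}} (hκ : κ.IsRegular) (h1 : ℵ₁ < κ)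
    (h2 : κ < 2 ^ ℵ₀) {p : ℕ} (hp : p.Prime) {G : Type u} [AddCommGroup G]
    (hG : IsPurelyUniversal (fun A [AddCommGroup A] => IsSeparablePGroup p A) κ G) : False := by
  obtain ⟨L, _, _, hL, hmk⟩ := exists_isRegularOrder hκ
  rw [← hmk] at h1 h2
  have h0 : ℵ₀ < #L := aleph0_lt_aleph_one.trans h1
  have : Infinite L := infinite_iff.2 h0.le
  obtain ⟨c, hc, hguess⟩ := hL.exists_club_guessing h1
  obtain ⟨r⟩ := Cardinal.eq.1 (hG.card_eq.trans hmk.symm)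
  -- The shift makes every initial segment nonempty, so closure puts `0 : G` in it.
  let c' : L → ℕ → L := fun δ n => c δ (n + 1)
  have hX : ∀ X : Set ℕ, ∃ q : L × G, ∀ n m,
      (∃ y z, r y < c' q.1 n ∧ q.2 = y + p ^ m • z) ↔ ∀ j ∈ X, ¬ (n ≤ j ∧ j < m) := by
    intro X
    obtain ⟨K, hK, ⟨e⟩⟩ := hG.exists_pure (seriesGroup p c' X) (infinite_seriesGroup hp c' X)
      (isSeparablePGroup_seriesGroup p c' X) ((mk_seriesGroup_le p c' X).trans_eq hmk)
    obtain ⟨δ, g, h⟩ := hL.exists_series_invariant h0 hp r (c := c') (X := X)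
      (φ := K.subtype.comp e.toAddMonoidHom)
      (fun δ a b hab => hc δ (Nat.succ_lt_succ hab)) (fun δ n => ⟨c δ 0, hc δ n.succ_pos⟩)
      (fun F => (hguess F).imp fun δ hδ n => hδ (n + 1))
      (fun m h g hg => hK.exists_smul_eq e hg)
    exact ⟨(δ, g), h⟩
  choose q hq using hX
  have hinj : Function.Injective q := by
    intro X Y hXY
    ext n
    -- With `m = n + 1` the window is `{n}`, so the invariant decides `n ∈ X`.
    have h1 := hq X n (n + 1)
    have h2 := hq Y n (n + 1)
    rw [hXY, h2] at h1
    have key : ∀ Z : Set ℕ, (∀ j ∈ Z, ¬ (n ≤ j ∧ j < n + 1)) ↔ n ∉ Z := fun Z =>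
      ⟨fun h hn => h n hn ⟨le_rfl, n.lt_succ_self⟩, fun h j hj hn =>
        h ((show n = j by omega) ▸ hj)⟩
    rw [key, key, not_iff_not] at h1
    exact h1.symm
  have h3 := mk_le_of_injective (Function.Injective.comp hinj (Equiv.ulift.{u}.injective))
  have h4 : #(L × G) = #L := by
    rw [← mul_def, hG.card_eq, ← hmk, mul_eq_self h0.le]
  rw [h4, mk_uLift, mk_set, mk_nat] at h3
  simp only [lift_power, lift_aleph0, lift_two] at h3
  exact absurd h2 (not_lt.2 h3)

/-! ### Countable powers of ℵ_n -/

/-- Hausdorff's argument: a countable sequence in ℵ_{n+1} is bounded, hence lies in one of ℵ_{n+1}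
initial segments of size at most ℵ_n. -/
theorem aleph_natCast_power_aleph0_le (n : ℕ) :
    (ℵ_ (n : Ordinal.{u})) ^ (ℵ₀ : Cardinal.{u}) ≤ max (ℵ_ (n : Ordinal.{u})) (2 ^ ℵ₀) := by
  induction n with
  | zero => simp
  | succ n ih =>
    set κ : Cardinal.{u} := ℵ_ ((n + 1 : ℕ) : Ordinal.{u}) with hκ
    have hsucc : κ = Order.succ (ℵ_ (n : Ordinal.{u})) := by
      rw [hκ, Nat.cast_succ, ← succ_aleph]
    have hreg : κ.IsRegular := by rw [hsucc]; exact isRegular_succ (aleph0_le_aleph _)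
    have h0 : ℵ₀ < κ := by rw [hsucc]; exact (aleph0_le_aleph _).trans_lt (Order.lt_succ _)
    obtain ⟨L, _, _, hL, hmk⟩ := exists_isRegularOrder hreg
    have hbound : ∀ f : ULift.{u} ℕ → L, ∃ b, ∀ k, f k ≤ b := fun f =>
      (hL.bdd_countable (h0.trans_eq hmk.symm) f).imp fun b hb k => (hb k).le
    choose b hb using hbound
    let Ψ : (ULift.{u} ℕ → L) → Σ a : L, ULift.{u} ℕ → Set.Iic a :=
      fun f => ⟨b f, fun k => ⟨f k, hb f k⟩⟩
    have hΨ : Function.Injective Ψ := by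
      intro f g h
      have : ∀ s t : (Σ a : L, ULift.{u} ℕ → Set.Iic a), s = t → ∀ k, (s.2 k).1 = (t.2 k).1 := by
        rintro s _ rfl k; rfl
      exact funext fun k => this _ _ h k
    have h1 := mk_le_of_injective hΨ
    rw [mk_sigma] at h1
    have h2 : κ ^ (ℵ₀ : Cardinal.{u}) = #(ULift.{u} ℕ → L) := by
      rw [← power_def, hmk, mk_uLift, mk_nat, lift_aleph0]
    rw [h2]
    refine h1.trans ((sum_le_sum _ (fun _ => max κ (2 ^ ℵ₀)) fun a => ?_).trans ?_)
    · rw [← power_def, mk_uLift, mk_nat, lift_aleph0]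
      have := hL.iic a
      rw [hmk, hsucc, Order.lt_succ_iff] at this
      refine (power_le_power_right this).trans (ih.trans (max_le_max_right _ ?_))
      rw [hsucc]; exact Order.le_succ _
    · rw [sum_const', hmk]
      exact (mul_le_mul_left (le_max_left _ _) _).trans_eq
        (mul_eq_self (h0.le.trans (le_max_left _ _)))

/-! ### The universal group above the continuum -/

section
variable {p : ℕ} {A : Type u} {D : Type*} [AddCommGroup A] [AddCommGroup D]

theorem injective_of_injOn_socle (hA : IsPGroup p (Multiplicative A)) (f : A →+ D)
    (hf : ∀ a, p • a = 0 → f a = 0 → a = 0) : Function.Injective f := by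
  rw [injective_iff_map_eq_zero]
  intro a ha
  obtain ⟨k, hk⟩ := isPGroup_multiplicative_iff.1 hA a
  induction k with
  | zero => simpa using hk
  | succ k ih =>
    apply ih
    apply hf
    · rw [← mul_smul, ← pow_succ', hk]
    · rw [map_nsmul, ha, smul_zero]

theorem surjective_zsmul_finsupp {ι D : Type*} [AddCommGroup D] [DivisibleBy D ℤ] {n : ℤ}
    (hn : n ≠ 0) : Function.Surjective fun a : ι →₀ D => n • a := by
  intro x
  induction x using Finsupp.induction_linear with
  | zero => exact ⟨0, smul_zero _⟩
  | add x y hx hy =>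
    obtain ⟨x, rfl⟩ := hx
    obtain ⟨y, rfl⟩ := hy
    exact ⟨x + y, smul_add _ _ _⟩
  | single i a =>
    refine ⟨Finsupp.single i (DivisibleBy.div a n), ?_⟩
    change n • Finsupp.single i (DivisibleBy.div a n) = _
    rw [Finsupp.smul_single, DivisibleBy.div_cancel a hn]

theorem baer_finsupp {ι : Type u} {D : Type*} [AddCommGroup D] [DivisibleBy D ℤ] :
    Module.Baer ℤ (ι →₀ D) :=
  let _ : DivisibleBy (ι →₀ D) ℤ := divisibleByOfSMulRightSurj _ _ surjective_zsmul_finsupp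
  Module.Baer.of_divisible (ι →₀ D)

/-- Injectivity of `D` extends `g` to `A`; the extension stays injective because every nonzero
element of a `p`-group has a nonzero multiple in the socle. -/
theorem exists_injective_of_socle {p : ℕ} {A : Type u} {D : Type*} [AddCommGroup A] [AddCommGroup D]
    (hA : IsPGroup p (Multiplicative A)) (hD : Module.Baer ℤ D)
    (g : (nsmulAddMonoidHom (α := A) p).ker →+ D) (hg : Function.Injective g) :
    ∃ f : A →+ D, Function.Injective f := by
  obtain ⟨f, hf⟩ := hD.extension_property_addMonoidHom
    (AddSubgroup.subtype _) (AddSubgroup.subtype_injective _) g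
  refine ⟨f, injective_of_injOn_socle hA f fun a ha hfa => ?_⟩
  have : g ⟨a, ha⟩ = 0 := (DFunLike.congr_fun hf ⟨a, ha⟩).symm.trans hfa
  exact congrArg Subtype.val (hg (this.trans (map_zero g).symm))

theorem exists_injective_finsupp_zmod {p : ℕ} [Fact p.Prime] {S ι : Type u} [AddCommGroup S]
    (hS : ∀ s : S, p • s = 0) (h : #S ≤ #ι) :
    ∃ f : S →+ (ι →₀ ZMod p), Function.Injective f := by
  let _ : Module (ZMod p) S := AddCommGroup.zmodModule hS
  let b := Module.Basis.ofVectorSpace (ZMod p) S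
  obtain ⟨j⟩ := (mk_set_le (Module.Basis.ofVectorSpaceIndex (ZMod p) S)).trans h
  exact ⟨(Finsupp.embDomain.addMonoidHom j).comp b.repr.toLinearMap.toAddMonoidHom,
    (Finsupp.embDomain_injective j).comp b.repr.injective⟩

theorem exists_injective_finsupp_addCircle (hp : p.Prime) (hA : IsPGroup p (Multiplicative A))
    {ι : Type u} (h : #A ≤ #ι) :
    ∃ f : A →+ (ι →₀ UnitAddCircle), Function.Injective f := by
  have : Fact p.Prime := ⟨hp⟩
  have : NeZero p := ⟨hp.ne_zero⟩
  obtain ⟨g, hg⟩ := exists_injective_finsupp_zmod (S := (nsmulAddMonoidHom (α := A) p).ker)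
    (fun s => Subtype.ext s.2) ((mk_le_of_injective Subtype.val_injective).trans h)
  exact exists_injective_of_socle hA baer_finsupp
    ((Finsupp.mapRange.addMonoidHom (ZMod.toAddCircle (N := p))).comp g)
    ((Finsupp.mapRange_injective _ (map_zero _) (ZMod.toAddCircle_injective p)).comp hg)

/-- The `p`-torsion part of the product over `k` of the `p ^ k`-torsion of `D`. -/
def boundedTorsionProduct (p : ℕ) (D : Type u) [AddCommGroup D] : AddSubgroup (ℕ → D) where
  carrier := {f | (∀ k, p ^ k • f k = 0) ∧ ∃ N : ℕ, p ^ N • f = 0}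
  zero_mem' := ⟨fun k => smul_zero _, 0, smul_zero _⟩
  add_mem' := by
    rintro f g ⟨hf, N, hN⟩ ⟨hg, M, hM⟩
    refine ⟨fun k => by rw [Pi.add_apply, smul_add, hf, hg, add_zero], N + M, ?_⟩
    rw [smul_add, pow_add, mul_smul, mul_smul, smul_comm, hN, hM, smul_zero, smul_zero, zero_add]
  neg_mem' := by
    rintro f ⟨hf, N, hN⟩
    exact ⟨fun k => by rw [Pi.neg_apply, smul_neg, hf, neg_zero], N, by rw [smul_neg, hN, neg_zero]⟩

theorem isSeparablePGroup_boundedTorsionProduct :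
    IsSeparablePGroup p (boundedTorsionProduct p D) where
  isPGroup := isPGroup_multiplicative_iff.2 fun f => f.2.2.imp fun _ h => Subtype.ext h
  eq_zero_of_infinite_height g h := by
    ext k
    obtain ⟨x, hx⟩ := h k
    rw [← hx]
    exact x.2.1 k

theorem exists_nsmul_eq_of_pow_dvd (hp : p.Prime) (hA : IsPGroup p (Multiplicative A)) {q : ℕ}
    (hq : ¬ p ∣ q) (a : A) : ∃ b, q • b = a := by
  obtain ⟨k, hk⟩ := isPGroup_multiplicative_iff.1 hA a
  have hcop : Nat.Coprime (p ^ k) q := ((Nat.Prime.coprime_iff_not_dvd hp).2 hq).pow_left k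
  have h := Nat.gcd_eq_gcd_ab (p ^ k) q
  rw [hcop.gcd_eq_one] at h
  refine ⟨Nat.gcdB (p ^ k) q • a, ?_⟩
  have h1 : (1 : ℤ) • a = a := one_smul _ _
  push_cast at h
  rw [h, add_smul, mul_smul, mul_smul, smul_comm, ← Nat.cast_pow, natCast_zsmul, hk, smul_zero,
    zero_add] at h1
  rw [← natCast_zsmul]
  exact h1

/-- The k-th coordinate has kernel exactly `p ^ k A`, so separability gives injectivity. For purity,
write `n = p ^ m * q` with `p ∤ q`: if the image of `a` is divisible by `n`, its m-th coordinate
vanishes, so `a ∈ p ^ m A`, and `q` acts surjectively on `A`. -/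
theorem exists_pure_boundedTorsionProduct (hp : p.Prime) (hA : IsSeparablePGroup p A)
    (hD : ∀ (B : Type u) [AddCommGroup B], IsPGroup p (Multiplicative B) → #B ≤ #A →
      ∃ f : B →+ D, Function.Injective f) :
    ∃ K : AddSubgroup (boundedTorsionProduct p D), IsPureSubgroup K ∧ Nonempty (A ≃+ K) := by
  have hψ : ∀ k : ℕ, ∃ ψ : A →+ D, ψ.ker = (nsmulAddMonoidHom (α := A) (p ^ k)).range := by
    intro k
    let R := (nsmulAddMonoidHom (α := A) (p ^ k)).range
    obtain ⟨f, hf⟩ := hD (A ⧸ R) (isPGroup_multiplicative_iff.2 fun a => by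
      obtain ⟨a, rfl⟩ := QuotientAddGroup.mk_surjective a
      obtain ⟨k, hk⟩ := isPGroup_multiplicative_iff.1 hA.isPGroup a
      exact ⟨k, by rw [← QuotientAddGroup.mk_nsmul, hk, QuotientAddGroup.mk_zero]⟩)
      (mk_le_of_surjective QuotientAddGroup.mk_surjective)
    refine ⟨f.comp (QuotientAddGroup.mk' R), ?_⟩
    rw [AddMonoidHom.ker_comp_of_injective _ _ hf, QuotientAddGroup.ker_mk']
  choose ψ hψ using hψ
  have hψ0 : ∀ k a, ψ k a = 0 ↔ ∃ x, p ^ k • x = a := fun k a => by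
    rw [← AddMonoidHom.mem_ker, hψ]; rfl
  let φ : A →+ boundedTorsionProduct p D :=
    (AddMonoidHom.pi ψ).codRestrict (boundedTorsionProduct p D) fun a =>
      ⟨fun k => by
        change p ^ k • ψ k a = 0
        rw [← map_nsmul, hψ0]
        exact ⟨a, rfl⟩, by
        obtain ⟨N, hN⟩ := isPGroup_multiplicative_iff.1 hA.isPGroup a
        exact ⟨N, by rw [← map_nsmul, hN, map_zero]⟩⟩
  have hφ : ∀ a k, (φ a).1 k = ψ k a := fun a k => rfl
  have hinj : Function.Injective φ := by
    rw [injective_iff_map_eq_zero]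
    intro a ha
    refine hA.eq_zero_of_infinite_height a fun k => ?_
    rw [← hψ0, ← hφ, ha]
    rfl
  refine ⟨φ.range, fun n => le_antisymm ?_ ?_, ⟨AddMonoidHom.ofInjective hinj⟩⟩
  · rintro _ ⟨_, ⟨a, rfl⟩, rfl⟩
    exact ⟨⟨_, rfl⟩, ⟨n • a, map_nsmul _ _ _⟩⟩
  · rintro _ ⟨⟨g, rfl⟩, ⟨a, ha⟩⟩
    rw [nsmulAddMonoidHom_apply] at ha ⊢
    suffices ∃ b, n • b = a by
      obtain ⟨b, rfl⟩ := this
      exact ⟨φ b, ⟨b, rfl⟩, by rw [← ha, map_nsmul]; rfl⟩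
    rcases eq_or_ne n 0 with rfl | hn
    · exact ⟨0, hinj (by rw [ha]; simp)⟩
    obtain ⟨m, q, hq, rfl⟩ := Nat.exists_eq_pow_mul_and_not_dvd hn p hp.ne_one
    obtain ⟨x, rfl⟩ := (hψ0 m a).1 (by
      rw [← hφ, ha]
      change (p ^ m * q) • g.1 m = 0
      rw [mul_comm, mul_smul, g.2.1, smul_zero])
    obtain ⟨b, rfl⟩ := exists_nsmul_eq_of_pow_dvd hp hA.isPGroup hq x
    exact ⟨b, mul_smul _ _ _⟩

theorem exists_isPurelyUniversal {κ : Cardinal.{u}} (hκ : κ ^ (ℵ₀ : Cardinal.{u}) = κ)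
    (h0 : ℵ₀ ≤ κ) (h : 2 ^ ℵ₀ ≤ κ) (hp : p.Prime) :
    ∃ (G : Type u) (_ : AddCommGroup G),
      IsPurelyUniversal (fun A [AddCommGroup A] => IsSeparablePGroup p A) κ G := by
  have : NeZero p := ⟨hp.ne_zero⟩
  have : Fact (1 < p) := ⟨hp.one_lt⟩
  obtain ⟨ι, rfl⟩ : ∃ ι : Type u, #ι = κ := ⟨_, mk_out κ⟩
  have : Infinite ι := infinite_iff.2 h0
  have hD : #(ι →₀ UnitAddCircle) = #ι := by
    have : Nontrivial UnitAddCircle := (ZMod.toAddCircle_injective p).nontrivial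
    have hc : #UnitAddCircle ≤ 𝔠 :=
      (mk_le_of_surjective
        (QuotientAddGroup.mk_surjective (s := AddSubgroup.zmultiples (1 : ℝ)))).trans_eq mk_real
    rw [mk_finsupp_lift_of_infinite, lift_uzero, max_eq_left]
    refine (lift_le.2 hc).trans ?_
    rwa [lift_continuum, ← two_power_aleph0]
  refine ⟨boundedTorsionProduct p (ι →₀ UnitAddCircle), inferInstance,
    isSeparablePGroup_boundedTorsionProduct, le_antisymm ?_ ?_, fun H _ _ hH hcard => ?_⟩
  · refine (mk_le_of_injective Subtype.val_injective).trans ?_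
    rw [mk_arrow]
    simp [hD, hκ]
  · let t : UnitAddCircle := ZMod.toAddCircle (1 : ZMod p)
    have ht : t ≠ 0 := by simp [t]
    have htp : p • t = 0 := by
      rw [← map_nsmul]; simp
    refine mk_le_of_injective (f := fun i =>
      (⟨Pi.single 1 (Finsupp.single i t), fun k => ?_, 1, ?_⟩ :
        boundedTorsionProduct p (ι →₀ UnitAddCircle))) fun i j hij => ?_
    · rcases eq_or_ne k 1 with rfl | hk
      · simp [htp]
      · simp [Pi.single_eq_of_ne hk]
    · rw [pow_one, ← Pi.single_smul, Finsupp.smul_single, htp]; simp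
    · have := congrFun (congrArg Subtype.val hij) 1
      simp only [Pi.single_eq_same] at this
      exact Finsupp.single_left_injective ht this
  · exact exists_pure_boundedTorsionProduct hp hH fun B _ hB hBc =>
      exists_injective_finsupp_addCircle hp hB (hBc.trans hcard)

end

theorem corollary3p4 (p : ℕ) (hp : p.Prime) (n : ℕ) (hn : 2 ≤ n) :
    (∃ (G : Type u) (_ : AddCommGroup G),
      IsPurelyUniversal (fun A [AddCommGroup A] => IsSeparablePGroup p A) (ℵ_ (n : Ordinal.{u})) G) ↔
    2 ^ ℵ₀ ≤ ℵ_ (n : Ordinal.{u}) := by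
  refine ⟨fun ⟨G, _, hG⟩ => ?_, fun h => ?_⟩
  · obtain ⟨n, rfl⟩ : ∃ k, n = k + 1 := ⟨n - 1, by omega⟩
    by_contra! hlt
    refine not_isPurelyUniversal_of_lt_continuum ?_ ?_ hlt hp hG
    · rw [Nat.cast_succ]
      exact isRegular_aleph_add_one _
    · rw [aleph_lt_aleph]
      exact_mod_cast (by omega : 1 < n + 1)
  · refine exists_isPurelyUniversal (le_antisymm ?_ ?_) (aleph0_le_aleph _) h hp
    · exact (aleph_natCast_power_aleph0_le n).trans_eq (max_eq_left h)
    · exact self_le_power _ one_le_aleph0
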